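/- A Cantor set is a nonempty compact zero-dimensional metric space without isolated points. Let $(C,T)$ be a minimal Cantor system, i.e. $C$ is a Cantor set and $T\colon C\to C$ is a continuous (not necessarily invertible) map all of whose forward orbits $\{T^n(x): n\ge 0\}$ are dense in $C$. Then $(C,T)$ can be realized as a minimal subsystem of a differentiable interval map whose derivative vanishes on it: there exist a differentiable map $f\colon[0,1]\to[0,1]$ (with one-sided derivatives at the endpoints), a nonempty closed set $K\subseteq[0,1]$ with $f(K)\subseteq K$ such that the forward $f$-orbit of every point of $K$ is dense in $K$, and a homeomorphism $\pi\colon C\to K$ such that $f\circ\pi=\pi\circ T$ on $C$ and $f'(y)=0$ for every $y\in K$. -/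

import Mathlib

open Set Function

/-- A Cantor set: a nonempty compact zero-dimensional metric space without isolated points.
Zero-dimensional means that the clopen sets form a basis of the topology. -/
structure IsCantorSpace (C : Type*) [MetricSpace C] : Prop where
  nonempty : Nonempty C
  compact : CompactSpace C
  zeroDimensional : TopologicalSpace.IsTopologicalBasis {s : Set C | IsClopen s}
  noIsolated : ∀ x : C, ¬ IsOpen ({x} : Set C)

/-- A minimal Cantor system `(C, T)`: `T` is a continuous (not necessarily invertible) self-map
of a Cantor set, and every forward orbit is dense. -/
structure IsMinimalCantorSystem {C : Type*} [MetricSpace C] (T : C → C) : Prop where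
  cantor : IsCantorSpace C
  continuous : Continuous T
  dense_orbit : ∀ x : C, Dense (range fun n : ℕ => T^[n] x)

/-- A differentiable system `([0,1], f)`: only the values of `f` on `[0,1]` matter, and at the
end points differentiability is one-sided. -/
structure IsDifferentiableIntervalSystem (f : ℝ → ℝ) : Prop where
  mapsTo : MapsTo f (Icc 0 1) (Icc 0 1)
  differentiableOn : DifferentiableOn ℝ f (Icc 0 1)

/-- `K` is a minimal subsystem of `([0,1], f)`: a nonempty closed invariant subset of `[0,1]`
in which the forward orbit of each of its points is dense. -/
structure IsMinimalSubsystem (f : ℝ → ℝ) (K : Set ℝ) : Prop where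
  subset : K ⊆ Icc 0 1
  nonempty : K.Nonempty
  isClosed : IsClosed K
  mapsTo : MapsTo f K K
  dense_orbit : ∀ x ∈ K, K ⊆ closure (range fun n : ℕ => f^[n] x)

/-! It suffices to embed `C` in `[0,1]` so that `T`, transported to the image `K`, satisfies |g x -
g y| = o(|x - y|) at each y ∈ K. Filling the gaps of `K` with smoothsteps then extends g
differentiably with derivative 0 on `K` (`exists_differentiable_extension`).

The embedding is a sum of `D n x * ι n x` over a refining sequence of clopen partitions. Points
first separated at level n + 1 lie at distance at least `D n x / 2`, and points sharing a level-l
class at distance at most `2 * k l * D l x`. So `T` has to send classes into classes whose spacing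
is smaller by an unbounded factor. Spacings cannot shrink at every step of a recurrent orbit, so
some steps must be exempt.

Fix a base point p with shrinking cells P_n. The level-(n + 1) spacing is allowed to grow only when
T x ∈ P_n \ P_{n+1}. For fixed x this happens for finitely many n: if T x ≠ p, then T x eventually
leaves P_n, and if T x = p, it lies in every P_n. Hence the derivative is zero at every point,
though with no uniformity.

The partitions record the itinerary up to the first visit to P_n, so `T` respects their classes off
P_n (`code_map`). A point x ≠ p is eventually off P_n. At p itself one level is lost
(`code_map_base`), and the scales of the spacing are ordered so as to pay for it
(`spacing_map_base_le`). Minimality gives bounded return times, and aperiodicity makes returns to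
P_{n+1} slow compared with returns to P_n (`exists_isReturnScheme`). -/

/-! ### Differentiable extension across the gaps of a closed set -/

/-- The cubic smoothstep `3 t ^ 2 - 2 t ^ 3`. -/
def smoothstep (t : ℝ) : ℝ := 3 * t ^ 2 - 2 * t ^ 3

theorem smoothstep_nonneg {t : ℝ} (h1 : t ≤ 1) : 0 ≤ smoothstep t := by
  have : smoothstep t = t ^ 2 * (3 - 2 * t) := by unfold smoothstep; ring
  rw [this]
  exact mul_nonneg (sq_nonneg t) (by linarith)

theorem smoothstep_one_sub (t : ℝ) : smoothstep (1 - t) = 1 - smoothstep t := by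
  unfold smoothstep; ring

theorem smoothstep_le_one {t : ℝ} (h0 : 0 ≤ t) : smoothstep t ≤ 1 := by
  have := smoothstep_nonneg (t := 1 - t) (by linarith)
  rw [smoothstep_one_sub] at this
  linarith

theorem smoothstep_le_sq {t : ℝ} (h0 : 0 ≤ t) : smoothstep t ≤ 3 * t ^ 2 := by
  unfold smoothstep
  have : 0 ≤ t ^ 3 := by positivity
  linarith

/-- `f` agrees with `g` on `K` and interpolates `g` by a smoothstep on every gap of `K`. -/
structure IsGapInterpolation (K : Set ℝ) (g f : ℝ → ℝ) : Prop where
  eqOn : EqOn f g K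
  gap : ∀ a ∈ K, ∀ b ∈ K, a < b → Ioo a b ∩ K = ∅ → ∀ z ∈ Icc a b,
    f z = g a + (g b - g a) * smoothstep ((z - a) / (b - a))

/-- Reflection reduces left-sided estimates to right-sided ones; the symmetry of the smoothstep
about its midpoint preserves the form. -/
theorem IsGapInterpolation.comp_neg {K : Set ℝ} {g f : ℝ → ℝ} (h : IsGapInterpolation K g f) :
    IsGapInterpolation (Neg.neg ⁻¹' K) (fun x => g (-x)) (fun x => f (-x)) where
  eqOn := fun x hx => h.eqOn hx
  gap := by
    intro a ha b hb hab hK z hz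
    have hK' : Ioo (-b) (-a) ∩ K = ∅ := by
      rw [eq_empty_iff_forall_notMem] at hK ⊢
      rintro x ⟨⟨h1, h2⟩, hx⟩
      exact hK (-x) ⟨⟨by linarith, by linarith⟩, by simpa using hx⟩
    have := h.gap (-b) hb (-a) ha (by linarith) hK' (-z) ⟨by linarith [hz.2], by linarith [hz.1]⟩
    rw [this]
    have hne : b - a ≠ 0 := by linarith
    have e : (-z - -b) / (-a - -b) = 1 - (z - a) / (b - a) := by
      rw [show -a - -b = b - a by ring]
      field_simp
      ring
    rw [e, smoothstep_one_sub]
    ring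

/-- The complement of a closed set that is unbounded in both directions consists of gaps. -/
theorem exists_gap {K : Set ℝ} (hK : IsClosed K) (hl : ∀ z, ∃ a ∈ K, a ≤ z)
    (hr : ∀ z, ∃ b ∈ K, z ≤ b) {z : ℝ} (hz : z ∉ K) :
    ∃ a ∈ K, ∃ b ∈ K, z ∈ Ioo a b ∧ Ioo a b ∩ K = ∅ := by
  have hA : IsClosed (K ∩ Iic z) := hK.inter isClosed_Iic
  have hB : IsClosed (K ∩ Ici z) := hK.inter isClosed_Ici
  have hAb : BddAbove (K ∩ Iic z) := ⟨z, fun x hx => hx.2⟩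
  have hBb : BddBelow (K ∩ Ici z) := ⟨z, fun x hx => hx.2⟩
  obtain ⟨a, ha⟩ := hl z
  obtain ⟨b, hb⟩ := hr z
  have h1 := hA.csSup_mem ⟨a, ha⟩ hAb
  have h2 := hB.csInf_mem ⟨b, hb⟩ hBb
  refine ⟨_, h1.1, _, h2.1, ⟨lt_of_le_of_ne h1.2 ?_, lt_of_le_of_ne h2.2 ?_⟩, ?_⟩
  · intro h; exact hz (h ▸ h1.1)
  · intro h; exact hz (h.symm ▸ h2.1)
  · rw [eq_empty_iff_forall_notMem]
    rintro x ⟨⟨hx1, hx2⟩, hx⟩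
    rcases le_total x z with h | h
    · exact absurd (le_csSup hAb ⟨hx, h⟩) (not_le.2 hx1)
    · exact absurd (csInf_le hBb ⟨hx, h⟩) (not_le.2 hx2)

theorem gap_unique {K : Set ℝ} {a b a' b' z : ℝ} (ha : a ∈ K) (hb : b ∈ K) (ha' : a' ∈ K)
    (hb' : b' ∈ K) (hz : z ∈ Ioo a b) (hz' : z ∈ Ioo a' b') (h : Ioo a b ∩ K = ∅)
    (h' : Ioo a' b' ∩ K = ∅) : a = a' ∧ b = b' := by
  rw [eq_empty_iff_forall_notMem] at h h'
  refine ⟨le_antisymm ?_ ?_, le_antisymm ?_ ?_⟩ <;> by_contra! hlt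
  · exact h' a ⟨⟨hlt, hz.1.trans hz'.2⟩, ha⟩
  · exact h a' ⟨⟨hlt, hz'.1.trans hz.2⟩, ha'⟩
  · exact h b' ⟨⟨hz.1.trans hz'.2, hlt⟩, hb'⟩
  · exact h' b ⟨⟨hz'.1.trans hz.2, hlt⟩, hb⟩

theorem exists_isGapInterpolation {K : Set ℝ} (hK : IsClosed K) (hl : ∀ z, ∃ a ∈ K, a ≤ z)
    (hr : ∀ z, ∃ b ∈ K, z ≤ b) (g : ℝ → ℝ) : ∃ f, IsGapInterpolation K g f := by
  classical
  choose! a ha b hb hz hgap using fun z (hz : z ∉ K) => exists_gap hK hl hr hz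
  refine ⟨fun z => if z ∈ K then g z else
    g (a z) + (g (b z) - g (a z)) * smoothstep ((z - a z) / (b z - a z)),
    fun z hz => by simp [hz], ?_⟩
  intro c hc d hd hcd hg z hzcd
  have hne : d - c ≠ 0 := by linarith
  by_cases hzK : z ∈ K
  · simp only [hzK, if_true]
    rcases eq_or_lt_of_le hzcd.1 with h1 | h1
    · subst h1; simp [smoothstep]
    rcases eq_or_lt_of_le hzcd.2 with h2 | h2
    · subst h2; rw [div_self hne]; norm_num [smoothstep]
    · exact absurd (show z ∈ Ioo c d ∩ K from ⟨⟨h1, h2⟩, hzK⟩) (by rw [hg]; simp)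
  · simp only [hzK, if_false]
    have h1 : c < z := lt_of_le_of_ne hzcd.1 (fun h => hzK (h ▸ hc))
    have h2 : z < d := lt_of_le_of_ne hzcd.2 (fun h => hzK (h ▸ hd))
    obtain ⟨e1, e2⟩ := gap_unique (ha z hzK) (hb z hzK) hc hd (hz z hzK) ⟨h1, h2⟩ (hgap z hzK) hg
    rw [e1, e2]

theorem IsGapInterpolation.differentiableAt {K : Set ℝ} {g f : ℝ → ℝ}
    (h : IsGapInterpolation K g f) (hK : IsClosed K) (hl : ∀ z, ∃ a ∈ K, a ≤ z)
    (hr : ∀ z, ∃ b ∈ K, z ≤ b) {z : ℝ} (hz : z ∉ K) : DifferentiableAt ℝ f z := by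
  obtain ⟨a, ha, b, hb, hzab, hg⟩ := exists_gap hK hl hr hz
  have : f =ᶠ[nhds z] fun z => g a + (g b - g a) * smoothstep ((z - a) / (b - a)) := by
    filter_upwards [Ioo_mem_nhds hzab.1 hzab.2] with x hx
    exact h.gap a ha b hb (hzab.1.trans hzab.2) hg x (Ioo_subset_Icc_self hx)
  refine DifferentiableAt.congr_of_eventuallyEq ?_ this
  unfold smoothstep
  fun_prop

/-- One-sided estimate for a gap interpolation at a point of `K` where `g` has zero derivative. -/
theorem IsGapInterpolation.eventually_right {K : Set ℝ} {g f : ℝ → ℝ}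
    (h : IsGapInterpolation K g f) (hK : IsClosed K) (hl : ∀ z, ∃ a ∈ K, a ≤ z)
    (hr : ∀ z, ∃ b ∈ K, z ≤ b) {y : ℝ} (hy : y ∈ K)
    (hg : ∀ ε > 0, ∃ δ > 0, ∀ x ∈ K, |x - y| < δ → |g x - g y| ≤ ε * |x - y|) {ε : ℝ}
    (hε : 0 < ε) : ∃ δ > 0, ∀ z, y ≤ z → z < y + δ → |f z - g y| ≤ ε * (z - y) := by
  obtain ⟨δ, hδ, hgδ⟩ := hg (ε / 3) (by positivity)
  -- Either some k ∈ K lies in (y, y + δ), and for z < k both ends of any gap around z stay in [y,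
  -- k]; or y is the left end of a gap.
  by_cases hk : ∃ k ∈ K, y < k ∧ k < y + δ
  · obtain ⟨k, hkK, hyk, hkδ⟩ := hk
    refine ⟨k - y, by linarith, fun z hyz hzk => ?_⟩
    have hest : ∀ x ∈ K, y ≤ x → x ≤ k → |g x - g y| ≤ ε / 3 * (x - y) := by
      intro x hx h1 h2
      have := hgδ x hx (by rw [abs_of_nonneg (by linarith)]; linarith)
      rwa [abs_of_nonneg (sub_nonneg.2 h1)] at this
    by_cases hz : z ∈ K
    · rw [h.eqOn hz]
      refine (hest z hz hyz (by linarith)).trans ?_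
      have : 0 ≤ ε * (z - y) := mul_nonneg hε.le (by linarith)
      linarith
    obtain ⟨a, ha, b, hb, hzab, hgap⟩ := exists_gap hK hl hr hz
    have hya : y ≤ a := by
      by_contra! hlt
      have : y ∈ Ioo a b ∩ K := ⟨⟨hlt, by linarith [hzab.2]⟩, hy⟩
      rw [hgap] at this; exact this
    have hbk : b ≤ k := by
      by_contra! hlt
      have : k ∈ Ioo a b ∩ K := ⟨⟨by linarith [hzab.1], hlt⟩, hkK⟩
      rw [hgap] at this; exact this
    have hab : a < b := hzab.1.trans hzab.2
    rw [h.gap a ha b hb hab hgap z (Ioo_subset_Icc_self hzab)]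
    set t := (z - a) / (b - a) with ht
    have hba : 0 < b - a := by linarith
    have ht0 : 0 ≤ t := div_nonneg (by linarith [hzab.1]) hba.le
    have ht1 : t ≤ 1 := (div_le_one hba).2 (by linarith [hzab.2])
    have hta : t * (b - a) = z - a := div_mul_cancel₀ _ hba.ne'
    have p0 := smoothstep_nonneg ht1
    have p1 := smoothstep_le_one ht0
    -- This linear bound replaces the weight of the far end b by 3(z - a), however long the gap is;
    -- hence the ε / 3 above.
    have p2 : smoothstep t ≤ 3 * t := (smoothstep_le_sq ht0).trans (by nlinarith)
    have e : g a + (g b - g a) * smoothstep t - g y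
        = (1 - smoothstep t) * (g a - g y) + smoothstep t * (g b - g y) := by ring
    rw [e]
    have ea := hest a ha hya (by linarith)
    have eb := hest b hb (by linarith) hbk
    calc |(1 - smoothstep t) * (g a - g y) + smoothstep t * (g b - g y)|
        ≤ (1 - smoothstep t) * |g a - g y| + smoothstep t * |g b - g y| := by
          refine (abs_add_le _ _).trans ?_
          rw [abs_mul, abs_mul, abs_of_nonneg p0, abs_of_nonneg (sub_nonneg.2 p1)]
      _ ≤ (1 - smoothstep t) * (ε / 3 * (a - y)) + smoothstep t * (ε / 3 * (b - y)) := by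
          have := sub_nonneg.2 p1
          gcongr
      _ = ε / 3 * ((a - y) + smoothstep t * (b - a)) := by ring
      _ ≤ ε / 3 * ((a - y) + 3 * t * (b - a)) := by gcongr
      _ = ε / 3 * ((a - y) + 3 * (z - a)) := by rw [mul_assoc, hta]
      _ ≤ ε / 3 * (3 * (z - y)) := by
          gcongr
          linarith
      _ = ε * (z - y) := by ring
  · push Not at hk
    have hz0 : y + δ / 2 ∉ K := fun hK' => by
      have := hk _ hK' (by linarith)
      linarith
    obtain ⟨a, ha, b, hb, hzab, hgap⟩ := exists_gap hK hl hr hz0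
    have hya : y = a := by
      rcases lt_trichotomy y a with hlt | heq | hlt
      · have := hk a ha hlt
        linarith [hzab.1]
      · exact heq
      · have : y ∈ Ioo a b ∩ K := ⟨⟨hlt, by linarith [hzab.2]⟩, hy⟩
        rw [hgap] at this; exact absurd this (by simp)
    subst hya
    have hyb : y < b := hzab.1.trans hzab.2
    -- Inside a single gap the quadratic vanishing of the smoothstep at 0 gives the bound c (z -
    -- y)².
    set c := 3 * (|g b - g y| + 1) / (b - y) ^ 2 with hc
    have hcpos : 0 < c := by
      have : 0 < b - y := by linarith
      positivity
    refine ⟨min (b - y) (ε / c), lt_min (by linarith) (by positivity), fun z hyz hz => ?_⟩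
    have hzb : z < b := by linarith [min_le_left (b - y) (ε / c)]
    have hzc : z - y ≤ ε / c := by linarith [min_le_right (b - y) (ε / c)]
    rw [h.gap y hy b hb hyb hgap z ⟨hyz, hzb.le⟩]
    set t := (z - y) / (b - y) with ht
    have hba : 0 < b - y := by linarith
    have ht0 : 0 ≤ t := div_nonneg (by linarith) hba.le
    have ht1 : t ≤ 1 := (div_le_one hba).2 (by linarith)
    have p0 := smoothstep_nonneg ht1
    have e : g y + (g b - g y) * smoothstep t - g y = (g b - g y) * smoothstep t := by ring
    rw [e, abs_mul, abs_of_nonneg p0]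
    calc |g b - g y| * smoothstep t ≤ (|g b - g y| + 1) * (3 * t ^ 2) :=
          mul_le_mul (by linarith) (smoothstep_le_sq ht0) p0 (by positivity)
      _ = c * (z - y) * (z - y) := by
          rw [hc, ht]; field_simp
      _ ≤ ε * (z - y) := by
          refine mul_le_mul_of_nonneg_right ?_ (by linarith)
          calc c * (z - y) ≤ c * (ε / c) := by gcongr
            _ = ε := by field_simp

theorem IsGapInterpolation.hasDerivAt {K : Set ℝ} {g f : ℝ → ℝ}
    (h : IsGapInterpolation K g f) (hK : IsClosed K) (hl : ∀ z, ∃ a ∈ K, a ≤ z)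
    (hr : ∀ z, ∃ b ∈ K, z ≤ b) {y : ℝ} (hy : y ∈ K)
    (hg : ∀ ε > 0, ∃ δ > 0, ∀ x ∈ K, |x - y| < δ → |g x - g y| ≤ ε * |x - y|) :
    HasDerivAt f 0 y := by
  rw [hasDerivAt_iff_isLittleO, Asymptotics.isLittleO_iff]
  intro ε hε
  obtain ⟨δ₁, hδ₁, h₁⟩ := h.eventually_right hK hl hr hy hg hε
  obtain ⟨δ₂, hδ₂, h₂⟩ := h.comp_neg.eventually_right (hK.preimage continuous_neg)
    (fun z => (hr (-z)).imp' Neg.neg fun b hb => ⟨by simpa using hb.1, by linarith [hb.2]⟩)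
    (fun z => (hl (-z)).imp' Neg.neg fun b hb => ⟨by simpa using hb.1, by linarith [hb.2]⟩)
    (y := -y) (by simpa using hy)
    (fun ε hε => (hg ε hε).imp fun δ hδ => ⟨hδ.1, fun x hx hxy => by
      have e : |x - -y| = |-x - y| := by rw [← abs_neg]; congr 1; ring
      simp only [neg_neg]
      rw [e] at hxy ⊢
      exact hδ.2 (-x) hx hxy⟩) hε
  filter_upwards [Ioo_mem_nhds (show y - min δ₁ δ₂ < y by
    linarith [lt_min hδ₁ hδ₂]) (show y < y + min δ₁ δ₂ by linarith [lt_min hδ₁ hδ₂])] with z hz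
  simp only [smul_zero, sub_zero, Real.norm_eq_abs, h.eqOn hy]
  rcases le_total y z with hyz | hyz
  · rw [abs_of_nonneg (sub_nonneg.2 hyz)]
    exact h₁ z hyz (by linarith [hz.2, min_le_left δ₁ δ₂])
  · rw [abs_of_nonpos (sub_nonpos.2 hyz)]
    have := h₂ (-z) (by linarith) (by linarith [hz.1, min_le_right δ₁ δ₂])
    simp only [neg_neg] at this
    refine this.trans (le_of_eq ?_)
    ring

theorem IsGapInterpolation.mem_Icc {K : Set ℝ} {g f : ℝ → ℝ}
    (h : IsGapInterpolation K g f) (hK : IsClosed K) (hl : ∀ z, ∃ a ∈ K, a ≤ z)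
    (hr : ∀ z, ∃ b ∈ K, z ≤ b) {c d : ℝ} (hg : ∀ x ∈ K, g x ∈ Icc c d) (z : ℝ) :
    f z ∈ Icc c d := by
  by_cases hz : z ∈ K
  · rw [h.eqOn hz]; exact hg z hz
  obtain ⟨a, ha, b, hb, hzab, hgap⟩ := exists_gap hK hl hr hz
  have hab : a < b := hzab.1.trans hzab.2
  have hba : 0 < b - a := by linarith
  rw [h.gap a ha b hb hab hgap z (Ioo_subset_Icc_self hzab)]
  have ht0 : 0 ≤ (z - a) / (b - a) := div_nonneg (by linarith [hzab.1]) hba.le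
  have ht1 : (z - a) / (b - a) ≤ 1 := (div_le_one hba).2 (by linarith [hzab.2])
  have := (convex_Icc c d) (hg a ha) (hg b hb) (sub_nonneg.2 (smoothstep_le_one ht0))
    (smoothstep_nonneg ht1) (by ring)
  simp only [smul_eq_mul] at this
  convert this using 1
  ring

/-- A function on a compact subset of `[0, 1]` with zero derivative extends to a differentiable
function with the same property. -/
theorem exists_differentiable_extension {K : Set ℝ} (hK : IsClosed K) (hK01 : K ⊆ Icc 0 1)
    {g : ℝ → ℝ} (hg01 : MapsTo g K (Icc 0 1))
    (hg : ∀ y ∈ K, ∀ ε > 0, ∃ δ > 0, ∀ x ∈ K, |x - y| < δ → |g x - g y| ≤ ε * |x - y|) :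
    ∃ f : ℝ → ℝ, EqOn f g K ∧ Differentiable ℝ f ∧ (∀ z, f z ∈ Icc (0 : ℝ) 1) ∧
      ∀ y ∈ K, HasDerivAt f 0 y := by
  classical
  -- The added rays make every complementary component a bounded gap. They are at distance at least
  -- 1 from `K`, so setting g to 0 there does not disturb the local estimates.
  set K' : Set ℝ := K ∪ (Iic (-1) ∪ Ici 2) with hK'
  set g' : ℝ → ℝ := fun x => if x ∈ K then g x else 0 with hg'
  have hc : IsClosed K' := hK.union (isClosed_Iic.union isClosed_Ici)
  have hl : ∀ z, ∃ a ∈ K', a ≤ z := fun z =>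
    ⟨min z (-1), Or.inr (Or.inl (mem_Iic.2 (min_le_right _ _))), min_le_left _ _⟩
  have hr : ∀ z, ∃ b ∈ K', z ≤ b := fun z =>
    ⟨max z 2, Or.inr (Or.inr (mem_Ici.2 (le_max_right _ _))), le_max_left _ _⟩
  obtain ⟨f, hf⟩ := exists_isGapInterpolation hc hl hr g'
  have hd : ∀ y ∈ K', HasDerivAt f 0 y := by
    intro y hy
    refine hf.hasDerivAt hc hl hr hy fun ε hε => ?_
    by_cases hyK : y ∈ K
    · obtain ⟨δ, hδ, h⟩ := hg y hyK ε hε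
      refine ⟨min δ 1, lt_min hδ one_pos, fun x hx hxy => ?_⟩
      have hxK : x ∈ K := by
        rcases hx with hx | hx | hx
        · exact hx
        · have := (abs_lt.1 (hxy.trans_le (min_le_right _ _))).1
          have := (hK01 hyK).1
          simp only [mem_Iic] at hx
          linarith
        · have := (abs_lt.1 (hxy.trans_le (min_le_right _ _))).2
          have := (hK01 hyK).2
          simp only [mem_Ici] at hx
          linarith
      simp only [hg', hyK, hxK, if_true]
      exact h x hxK (hxy.trans_le (min_le_left _ _))
    · refine ⟨1, one_pos, fun x hx hxy => ?_⟩
      have hxK : x ∉ K := fun hxK => by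
        obtain ⟨h1, h2⟩ := abs_lt.1 hxy
        have h3 := hK01 hxK
        rcases hy with hy | hy | hy
        · exact hyK hy
        · simp only [mem_Iic] at hy
          linarith [h3.1]
        · simp only [mem_Ici] at hy
          linarith [h3.2]
      simp only [hg', hyK, hxK, if_false, sub_self, abs_zero]
      positivity
  refine ⟨f, fun x hx => ?_, fun z => ?_, fun z => hf.mem_Icc hc hl hr (fun x _ => ?_) z,
    fun y hy => hd y (Or.inl hy)⟩
  · rw [hf.eqOn (Or.inl hx)]; simp [hg', hx]
  · by_cases hz : z ∈ K'
    · exact (hd z hz).differentiableAt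
    · exact hf.differentiableAt hc hl hr hz
  · by_cases hx : x ∈ K
    · simpa [hg', hx] using hg01 hx
    · simp [hg', hx]

/-! ### Tree-like embeddings into the unit interval -/

/-- Data for a tree-like embedding into `[0, 1]`: `e n` labels the classes of the `n`-th partition,
`ι n` numbers the classes of the next one, and `D n x` is the spacing inside the class of `x`. -/
structure IsTreeCoding {C β : Type*} [TopologicalSpace C] (e : ℕ → C → β) (ι : ℕ → C → ℕ)
    (k : ℕ → ℕ) (D : ℕ → C → ℝ) : Prop where
  isLocallyConstant : ∀ n, IsLocallyConstant (e n)
  trivial_zero : ∀ x y, e 0 x = e 0 y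
  refines : ∀ n x y, e (n + 1) x = e (n + 1) y → e n x = e n y
  separates : ∀ x y, (∀ n, e n x = e n y) → x = y
  index_eq_iff : ∀ n x y, ι n x = ι n y ↔ e (n + 1) x = e (n + 1) y
  index_lt : ∀ n x, ι n x < k n
  spacing_pos : ∀ n x, 0 < D n x
  spacing_congr : ∀ n x y, e n x = e n y → D n x = D n y
  spacing_succ : ∀ n x, 8 * k (n + 1) * D (n + 1) x ≤ D n x
  spacing_zero : ∀ x, 2 * k 0 * D 0 x ≤ 1

namespace IsTreeCoding

variable {C β : Type*} [TopologicalSpace C] {e : ℕ → C → β} {ι : ℕ → C → ℕ}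
    {k : ℕ → ℕ} {D : ℕ → C → ℝ}

theorem eq_of_le (h : IsTreeCoding e ι k D) {m n : ℕ} (hmn : m ≤ n) {x y : C}
    (hxy : e n x = e n y) : e m x = e m y := by
  induction n, hmn using Nat.le_induction with
  | base => exact hxy
  | succ n _ ih => exact ih (h.refines n x y hxy)

theorem one_le (h : IsTreeCoding e ι k D) (x : C) (n : ℕ) : (1 : ℝ) ≤ k n := by
  exact_mod_cast Nat.one_le_iff_ne_zero.2 (Nat.ne_zero_of_lt (h.index_lt n x))

theorem spacing_le (h : IsTreeCoding e ι k D) (x : C) (n m : ℕ) :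
    k (n + m) * D (n + m) x ≤ k n * D n x * (1 / 8) ^ m := by
  induction m with
  | zero => simp
  | succ m ih =>
    have h1 := h.spacing_succ (n + m) x
    have h2 : D (n + m) x ≤ k (n + m) * D (n + m) x :=
      le_mul_of_one_le_left (h.spacing_pos _ _).le (h.one_le x _)
    rw [pow_succ, ← add_assoc]
    linarith

theorem summable (h : IsTreeCoding e ι k D) (x : C) : Summable fun n => D n x * ι n x := by
  refine Summable.of_nonneg_of_le (fun n => mul_nonneg (h.spacing_pos n x).le (Nat.cast_nonneg _))
    (fun n => ?_) ((summable_geometric_of_lt_one (by norm_num : (0 : ℝ) ≤ 1 / 8)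
      (by norm_num)).mul_left (k 0 * D 0 x))
  have h1 := h.spacing_le x 0 n
  rw [zero_add] at h1
  refine le_trans ?_ h1
  rw [mul_comm]
  exact mul_le_mul_of_nonneg_right (by exact_mod_cast (h.index_lt n x).le) (h.spacing_pos n x).le

/-- The part of the embedding determined by the levels from `n` on. -/
noncomputable def tail (D : ℕ → C → ℝ) (ι : ℕ → C → ℕ) (n : ℕ) (x : C) : ℝ := ∑' m, D (n + m) x * ι (n + m) x

theorem tail_eq (h : IsTreeCoding e ι k D) (n : ℕ) (x : C) :
    tail D ι n x = D n x * ι n x + tail D ι (n + 1) x := by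
  have hs : Summable fun m => D (n + m) x * ι (n + m) x := by
    have := (summable_nat_add_iff n).2 (h.summable x)
    simpa only [add_comm] using this
  unfold tail
  rw [hs.tsum_eq_zero_add]
  simp only [add_zero]
  congr 2
  ext m
  rw [show n + (m + 1) = n + 1 + m by ring]

theorem tail_nonneg (h : IsTreeCoding e ι k D) (n : ℕ) (x : C) : 0 ≤ tail D ι n x :=
  tsum_nonneg fun _ => mul_nonneg (h.spacing_pos _ x).le (Nat.cast_nonneg _)

theorem tail_le (h : IsTreeCoding e ι k D) (n : ℕ) (x : C) :
    tail D ι n x ≤ 8 / 7 * (k n * D n x) := by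
  have hg := (hasSum_geometric_of_lt_one (by norm_num : (0 : ℝ) ≤ 1 / 8)
      (by norm_num)).mul_left (k n * D n x)
  have hs : Summable fun m => D (n + m) x * ι (n + m) x := by
    have := (summable_nat_add_iff n).2 (h.summable x)
    simpa only [add_comm] using this
  refine (hasSum_le (fun m => ?_) hs.hasSum hg).trans (le_of_eq (by norm_num; ring))
  refine le_trans ?_ (h.spacing_le x n m)
  rw [mul_comm]
  exact mul_le_mul_of_nonneg_right (by exact_mod_cast (h.index_lt _ x).le) (h.spacing_pos _ x).le

/-- The embedding. -/
noncomputable abbrev embed (D : ℕ → C → ℝ) (ι : ℕ → C → ℕ) : C → ℝ := tail D ι 0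

theorem embed_mem_Icc (h : IsTreeCoding e ι k D) (x : C) : embed D ι x ∈ Icc (0 : ℝ) 1 :=
  ⟨h.tail_nonneg 0 x, (h.tail_le 0 x).trans (by
    have := h.spacing_zero x
    have := mul_nonneg (Nat.cast_nonneg (α := ℝ) (k 0)) (h.spacing_pos 0 x).le
    linarith)⟩

theorem embed_sub_embed (h : IsTreeCoding e ι k D) {n : ℕ} {x y : C} (hxy : e n x = e n y) :
    embed D ι x - embed D ι y = tail D ι n x - tail D ι n y := by
  induction n with
  | zero => rfl
  | succ n ih =>
    have hn := h.refines n x y hxy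
    rw [ih hn, h.tail_eq n x, h.tail_eq n y, h.spacing_congr n x y hn, (h.index_eq_iff n x y).2 hxy]
    ring

theorem abs_embed_sub_le (h : IsTreeCoding e ι k D) {n : ℕ} {x y : C} (hxy : e n x = e n y) :
    |embed D ι x - embed D ι y| ≤ 2 * k n * D n x := by
  rw [h.embed_sub_embed hxy]
  have h1 := h.tail_le n x
  have h2 := h.tail_le n y
  rw [← h.spacing_congr n x y hxy] at h2
  have h3 := h.tail_nonneg n x
  have h4 := h.tail_nonneg n y
  have := mul_nonneg (Nat.cast_nonneg (α := ℝ) (k n)) (h.spacing_pos n x).le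
  rw [abs_le]
  constructor <;> linarith

/-- The level-n terms differ by a nonzero integer multiple of `D n x`, while the factor 8 in
`spacing_succ` keeps the deeper levels within `D n x / 7`. -/
theorem le_abs_embed_sub (h : IsTreeCoding e ι k D) {n : ℕ} {x y : C} (hxy : e n x = e n y)
    (hne : e (n + 1) x ≠ e (n + 1) y) : D n x / 2 ≤ |embed D ι x - embed D ι y| := by
  rw [h.embed_sub_embed hxy, h.tail_eq n x, h.tail_eq n y, ← h.spacing_congr n x y hxy]
  have hD := h.spacing_pos n x
  have hι : (1 : ℝ) ≤ |(ι n x : ℝ) - ι n y| := by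
    have : (ι n x : ℤ) - ι n y ≠ 0 := by
      intro h0
      exact hne ((h.index_eq_iff n x y).1 (by omega))
    exact_mod_cast Int.one_le_abs this
  have h1 := h.tail_le (n + 1) x
  have h2 := h.tail_le (n + 1) y
  have h3 := h.tail_nonneg (n + 1) x
  have h4 := h.tail_nonneg (n + 1) y
  have h5 := h.spacing_succ n x
  have h6 := h.spacing_succ n y
  rw [← h.spacing_congr n x y hxy] at h6
  have e1 : D n x * ι n x + tail D ι (n + 1) x - (D n x * ι n y + tail D ι (n + 1) y)
      = D n x * ((ι n x : ℝ) - ι n y) - (tail D ι (n + 1) y - tail D ι (n + 1) x) := by ring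
  rw [e1]
  refine le_trans ?_ (abs_sub_abs_le_abs_sub _ _)
  rw [abs_mul, abs_of_pos hD]
  have h7 : D n x ≤ D n x * |(ι n x : ℝ) - ι n y| := le_mul_of_one_le_right hD.le hι
  have h8 : |tail D ι (n + 1) y - tail D ι (n + 1) x| ≤ D n x / 7 := by
    rw [abs_le]
    constructor <;> linarith
  linarith

theorem exists_split (h : IsTreeCoding e ι k D) {x y : C} (hxy : x ≠ y) :
    ∃ n, e n x = e n y ∧ e (n + 1) x ≠ e (n + 1) y := by
  by_contra! hn
  refine hxy (h.separates x y fun n => ?_)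
  induction n with
  | zero => exact h.trivial_zero x y
  | succ n ih => exact hn n ih

theorem injective (h : IsTreeCoding e ι k D) : Injective (embed D ι) := by
  intro x y hxy
  by_contra hne
  obtain ⟨n, h1, h2⟩ := h.exists_split hne
  have := h.le_abs_embed_sub h1 h2
  rw [hxy, sub_self, abs_zero] at this
  linarith [h.spacing_pos n x]

theorem continuous (h : IsTreeCoding e ι k D) : Continuous (embed D ι) := by
  refine continuous_iff_continuousAt.2 fun x => Metric.tendsto_nhds.2 fun ε hε => ?_
  obtain ⟨n, hn⟩ := exists_pow_lt_of_lt_one hε (by norm_num : (1 / 8 : ℝ) < 1)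
  filter_upwards [(h.isLocallyConstant n).eventually_eq x] with y hy
  have h1 := h.abs_embed_sub_le hy.symm
  rw [Real.dist_eq, abs_sub_comm]
  refine lt_of_le_of_lt h1 (lt_of_le_of_lt ?_ hn)
  have h2 := h.spacing_le x 0 n
  have h3 := h.spacing_zero x
  rw [zero_add] at h2
  calc 2 * k n * D n x ≤ (2 * k 0 * D 0 x) * (1 / 8) ^ n := by linarith
    _ ≤ 1 * (1 / 8) ^ n := by gcongr
    _ = _ := one_mul _

end IsTreeCoding

/-! ### Return schemes and itinerary codes -/

/-- A sequence of finer and finer finite clopen partitions `q n` of a system `(C, T)` with a base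
point `p`. The cells of `p` form a rapidly shrinking sequence of return sets. -/
structure IsReturnScheme {C α : Type*} [TopologicalSpace C] (T : C → C) (p : C) (q : ℕ → C → α)
    (L : ℕ → ℕ) : Prop where
  continuous : Continuous T
  isLocallyConstant : ∀ n, IsLocallyConstant (q n)
  trivial_zero : ∀ x y, q 0 x = q 0 y
  refines : ∀ n x y, q (n + 1) x = q (n + 1) y → q n x = q n y
  separates : ∀ x y, (∀ n, q n x = q n y) → x = y
  returns : ∀ n x, ∃ j, 1 ≤ j ∧ j ≤ L n ∧ q n (T^[j] x) = q n p
  shadows : ∀ n y, q (n + 1) y = q (n + 1) p → ∀ j ≤ L n, q n (T^[j] y) = q n (T^[j] p)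
  not_returns : ∀ n y, q (n + 1) y = q (n + 1) p → ∀ j, 1 ≤ j → j ≤ L n →
    q (n + 1) (T^[j] y) ≠ q (n + 1) p

namespace IsReturnScheme

variable {C α : Type*} {T : C → C} {p : C} {q : ℕ → C → α}

/-- The first time at which the orbit of `x` visits the `n`-th cell of `p`. -/
noncomputable def hit (T : C → C) (p : C) (q : ℕ → C → α) (n : ℕ) (x : C) : ℕ :=
  sInf {j | q n (T^[j] x) = q n p}

theorem hit_le {n j : ℕ} {x : C} (h : q n (T^[j] x) = q n p) : hit T p q n x ≤ j :=
  Nat.sInf_le h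

/-- The itinerary of `x` up to its first visit to the `n`-th cell of `p`, together with the
information whether that visit is also one to the next cell of `p`. -/
noncomputable def code (T : C → C) (p : C) (q : ℕ → C → α) (n : ℕ) (x : C) :
    ℕ × (ℕ → Option α) × Prop :=
  (hit T p q n x, fun s => if s < hit T p q n x then some (q n (T^[s] x)) else none,
    hit T p q n x ≠ 0 ∧ hit T p q n x = hit T p q (n + 1) x)

theorem code_eq_iff {n : ℕ} {x y : C} : code T p q n x = code T p q n y ↔
    hit T p q n x = hit T p q n y ∧
    (∀ s < hit T p q n x, q n (T^[s] x) = q n (T^[s] y)) ∧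
    (hit T p q n x ≠ 0 → (hit T p q n x = hit T p q (n + 1) x ↔
      hit T p q n y = hit T p q (n + 1) y)) := by
  unfold code
  rw [Prod.mk.injEq, Prod.mk.injEq]
  refine and_congr_right fun h1 => and_congr ?_ ?_
  · rw [funext_iff]
    refine forall_congr' fun s => ?_
    rw [← h1]
    by_cases hs : s < hit T p q n x <;> simp [hs]
  · rw [eq_iff_iff, ← h1]
    tauto

variable [TopologicalSpace C] {L : ℕ → ℕ}

theorem hit_spec (h : IsReturnScheme T p q L) (n : ℕ) (x : C) :
    q n (T^[hit T p q n x] x) = q n p := by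
  obtain ⟨j, -, -, hj⟩ := h.returns n x
  exact Nat.sInf_mem (s := {j | q n (T^[j] x) = q n p}) ⟨j, hj⟩

theorem hit_le_bound (h : IsReturnScheme T p q L) (n : ℕ) (x : C) : hit T p q n x ≤ L n := by
  obtain ⟨j, -, hj, hj'⟩ := h.returns n x
  exact (hit_le hj').trans hj

theorem hit_eq_zero_iff (h : IsReturnScheme T p q L) {n : ℕ} {x : C} :
    hit T p q n x = 0 ↔ q n x = q n p := by
  constructor
  · intro h0
    have := h.hit_spec n x
    rwa [h0] at this
  · intro hx
    exact Nat.le_zero.1 (hit_le (j := 0) hx)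

theorem hit_map (h : IsReturnScheme T p q L) {n : ℕ} {x : C} (hx : hit T p q n x ≠ 0) :
    hit T p q n (T x) + 1 = hit T p q n x := by
  refine le_antisymm ?_ (hit_le (by rw [iterate_succ_apply]; exact h.hit_spec n (T x)))
  obtain ⟨m, hm⟩ := Nat.exists_eq_succ_of_ne_zero hx
  have := h.hit_spec n x
  rw [hm, Nat.succ_eq_add_one, iterate_succ_apply] at this
  rw [hm]
  exact Nat.succ_le_succ (hit_le this)

theorem hit_le_hit_succ (h : IsReturnScheme T p q L) (n : ℕ) (x : C) :
    hit T p q n x ≤ hit T p q (n + 1) x :=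
  hit_le (h.refines n _ _ (h.hit_spec (n + 1) x))

theorem hit_eq_hit_succ_iff (h : IsReturnScheme T p q L) (n : ℕ) (x : C) :
    hit T p q n x = hit T p q (n + 1) x ↔ q (n + 1) (T^[hit T p q n x] x) = q (n + 1) p := by
  constructor
  · intro he
    rw [he]; exact h.hit_spec _ _
  · intro hq
    exact le_antisymm (h.hit_le_hit_succ n x) (hit_le hq)

theorem hit_congr (h : IsReturnScheme T p q L) {n : ℕ} {x y : C}
    (hxy : ∀ j ≤ hit T p q n x, q n (T^[j] x) = q n (T^[j] y)) :
    hit T p q n x = hit T p q n y := by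
  have h1 : hit T p q n y ≤ hit T p q n x :=
    hit_le (by rw [← hxy _ le_rfl]; exact h.hit_spec n x)
  exact le_antisymm (hit_le (by rw [hxy _ h1]; exact h.hit_spec n y)) h1

theorem isLocallyConstant_code (h : IsReturnScheme T p q L) (n : ℕ) :
    IsLocallyConstant (code T p q n) := by
  rw [IsLocallyConstant.iff_eventually_eq]
  intro x
  have key : ∀ᶠ y in nhds x, ∀ j ∈ Finset.range (L n + 1),
      q (n + 1) (T^[j] x) = q (n + 1) (T^[j] y) := by
    rw [Filter.eventually_all_finset]
    intro j _
    exact (((h.isLocallyConstant (n + 1)).comp_continuous (h.continuous.iterate j)).eventually_eq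
      x).mono fun y hy => hy.symm
  filter_upwards [key] with y hy
  symm
  have hb := h.hit_le_bound n x
  have hy' : ∀ j ≤ hit T p q n x, q (n + 1) (T^[j] x) = q (n + 1) (T^[j] y) := fun j hj =>
    hy j (Finset.mem_range.2 (by omega))
  have h1 := h.hit_congr fun j hj => h.refines n _ _ (hy' j hj)
  refine code_eq_iff.2 ⟨h1, fun s hs => h.refines n _ _ (hy' s hs.le), fun _ => ?_⟩
  rw [h.hit_eq_hit_succ_iff, h.hit_eq_hit_succ_iff, ← h1, hy' _ le_rfl]

theorem code_zero (h : IsReturnScheme T p q L) (x y : C) : code T p q 0 x = code T p q 0 y := by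
  have h0 : ∀ z, hit T p q 0 z = 0 := fun z => h.hit_eq_zero_iff.2 (h.trivial_zero z p)
  exact code_eq_iff.2 ⟨by rw [h0, h0], by simp [h0], by simp [h0]⟩

/-- Codes at level `n + 1` determine orbits modulo the `n`-th partition up to the first visit. -/
theorem eq_of_code_succ (h : IsReturnScheme T p q L) {n : ℕ} {x y : C}
    (hxy : code T p q (n + 1) x = code T p q (n + 1) y) {j : ℕ} (hj : j ≤ hit T p q (n + 1) x) :
    q n (T^[j] x) = q n (T^[j] y) := by
  obtain ⟨h1, h2, -⟩ := code_eq_iff.1 hxy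
  refine h.refines n _ _ ?_
  rcases hj.lt_or_eq with hj | hj
  · exact h2 j hj
  · have := h.hit_spec (n + 1) y
    rw [← h1, ← hj] at this
    rw [this, hj]
    exact h.hit_spec (n + 1) x

theorem code_refines (h : IsReturnScheme T p q L) (n : ℕ) (x y : C)
    (hxy : code T p q (n + 1) x = code T p q (n + 1) y) : code T p q n x = code T p q n y := by
  have h3 : ∀ j ≤ hit T p q n x, q n (T^[j] x) = q n (T^[j] y) := fun j hj =>
    h.eq_of_code_succ hxy (hj.trans (h.hit_le_hit_succ n x))
  have h1 := h.hit_congr h3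
  exact code_eq_iff.2 ⟨h1, fun s hs => h3 s hs.le, fun _ => by
    rw [← h1, (code_eq_iff.1 hxy).1]⟩

theorem code_separates (h : IsReturnScheme T p q L) (x y : C)
    (hxy : ∀ n, code T p q n x = code T p q n y) : x = y := by
  refine h.separates x y fun n => ?_
  obtain ⟨h1, h2, -⟩ := code_eq_iff.1 (hxy n)
  rcases Nat.eq_zero_or_pos (hit T p q n x) with h0 | h0
  · rw [h.hit_eq_zero_iff.1 h0, h.hit_eq_zero_iff.1 (h1.symm.trans h0)]
  · exact h2 0 h0

/-- Off the cell of p one application of `T` shifts the itinerary and lowers both hitting times by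
one, so the flag comparing them is preserved. -/
theorem code_map (h : IsReturnScheme T p q L) {n : ℕ} {x y : C}
    (hxy : code T p q n x = code T p q n y) (hx : hit T p q n x ≠ 0) :
    code T p q n (T x) = code T p q n (T y) := by
  obtain ⟨h1, h2, h3⟩ := code_eq_iff.1 hxy
  have a1 := h.hit_map hx
  have a2 := h.hit_map (h1 ▸ hx)
  have b1 := h.hit_le_hit_succ n x
  have b2 := h.hit_le_hit_succ n y
  have c1 := h.hit_map (n := n + 1) (x := x) (by omega)
  have c2 := h.hit_map (n := n + 1) (x := y) (by omega)
  refine code_eq_iff.2 ⟨by omega, fun s hs => ?_, fun _ => ?_⟩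
  · have := h2 (s + 1) (by omega)
    rwa [iterate_succ_apply, iterate_succ_apply] at this
  · have := h3 hx
    omega

/-- A point of the cell of `p` does not return to it at the first return to the larger cell. -/
theorem hit_map_ne (h : IsReturnScheme T p q L) {n : ℕ} {y : C} (hy : q (n + 1) y = q (n + 1) p) :
    hit T p q n (T y) ≠ hit T p q (n + 1) (T y) := by
  intro he
  obtain ⟨j, hj1, hj, hj'⟩ := h.returns n y
  obtain ⟨i, rfl⟩ := Nat.exists_eq_succ_of_ne_zero (Nat.one_le_iff_ne_zero.1 hj1)
  have hi : hit T p q n (T y) ≤ i := hit_le (by rw [← iterate_succ_apply]; exact hj')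
  refine h.not_returns n y hy (hit T p q n (T y) + 1) (by omega) (by omega) ?_
  rw [iterate_succ_apply]
  exact (h.hit_eq_hit_succ_iff n (T y)).1 he

/-- Inside the cell of p the code says nothing about the future, so one level is given up: shadowing
lasts until the next return to the coarser cell, and at that return the flag is false for both
points. -/
theorem code_map_base (h : IsReturnScheme T p q L) {n : ℕ} {y : C}
    (hy : q (n + 1) y = q (n + 1) p) : code T p q n (T y) = code T p q n (T p) := by
  obtain ⟨j, hj1, hj, hj'⟩ := h.returns n y
  obtain ⟨i, rfl⟩ := Nat.exists_eq_succ_of_ne_zero (Nat.one_le_iff_ne_zero.1 hj1)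
  have hi : hit T p q n (T y) ≤ i := hit_le (by rw [← iterate_succ_apply]; exact hj')
  have key : ∀ s ≤ hit T p q n (T y), q n (T^[s] (T y)) = q n (T^[s] (T p)) := fun s hs => by
    rw [← iterate_succ_apply, ← iterate_succ_apply]
    exact h.shadows n y hy _ (by omega)
  refine code_eq_iff.2 ⟨h.hit_congr key, fun s hs => key s hs.le, fun _ => ?_⟩
  simp [h.hit_map_ne hy, h.hit_map_ne (rfl : q (n + 1) p = q (n + 1) p)]

/-- The guard `hit ≠ 0` in the flag keeps the cell of p from being subdivided. -/
theorem code_eq_base_iff (h : IsReturnScheme T p q L) {n : ℕ} {y : C} :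
    code T p q n y = code T p q n p ↔ q n y = q n p := by
  have hp : hit T p q n p = 0 := h.hit_eq_zero_iff.2 rfl
  rw [← h.hit_eq_zero_iff, code_eq_iff, hp]
  constructor
  · exact fun h => h.1
  · exact fun h => ⟨h, by simp [h], by simp [h]⟩

theorem hit_map_eq_of_code (h : IsReturnScheme T p q L) {n : ℕ} {x y : C}
    (hxy : code T p q (n + 1) x = code T p q (n + 1) y) (hx : hit T p q (n + 1) x ≠ 0) :
    hit T p q n (T x) = hit T p q n (T y) := by
  have hc := h.hit_map hx
  refine h.hit_congr fun j hj => ?_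
  rw [← iterate_succ_apply, ← iterate_succ_apply]
  refine h.eq_of_code_succ hxy ?_
  have := h.hit_le_hit_succ n (T x)
  omega

end IsReturnScheme

/-! ### Spacings that contract along orbits -/

theorem exists_rapidly_decreasing {M : ℕ → ℝ} (hM : ∀ n, 1 ≤ M n) : ∃ c : ℕ → ℝ,
    c 0 = 1 ∧ (∀ n, 0 < c n) ∧ (∀ n, c (n + 1) ≤ c n) ∧ ∀ m, ∀ i ≤ m, c (m + 1) * M i ≤ c m := by
  set W : ℕ → ℝ := fun m => ∑ i ∈ Finset.range (m + 1), M i with hW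
  have hWM : ∀ m, ∀ i ≤ m, M i ≤ W m := fun m i hi =>
    Finset.single_le_sum (fun j _ => zero_le_one.trans (hM j))
      (Finset.mem_range.2 (Nat.lt_succ_of_le hi))
  have hW1 : ∀ m, 1 ≤ W m := fun m => (hM 0).trans (hWM m 0 (Nat.zero_le m))
  set c : ℕ → ℝ := fun m => ∏ i ∈ Finset.range m, (W i)⁻¹ with hc
  have hpos : ∀ n, 0 < c n := fun n =>
    Finset.prod_pos fun i _ => inv_pos.2 (zero_lt_one.trans_le (hW1 i))
  have hstep : ∀ m, c (m + 1) * W m = c m := fun m => by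
    have : W m ≠ 0 := (zero_lt_one.trans_le (hW1 m)).ne'
    simp only [hc]
    rw [Finset.prod_range_succ, inv_mul_cancel_right₀ this]
  refine ⟨c, by simp [hc], hpos, fun n => ?_, fun m i hi => ?_⟩
  · rw [← hstep n]
    exact le_mul_of_one_le_right (hpos _).le (hW1 n)
  · rw [← hstep m]
    exact mul_le_mul_of_nonneg_left (hWM m i hi) (hpos _).le

/-- Scales `A n`, `b n`, `b' n` of spacings, decreasing rapidly in the order
`A n, b n, A (n + 1), b' n, b (n + 1), …`. -/
structure IsSpacingScale (A b b' M : ℕ → ℝ) : Prop where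
  pos : ∀ n, 0 < A n ∧ 0 < b n ∧ 0 < b' n
  late_le_early : ∀ n, b' n ≤ b n
  early_le : ∀ n, b n * M n ≤ A n
  main_succ_le : ∀ n, A (n + 1) * M (n + 1) ≤ b n
  early_succ_le : ∀ n, b (n + 1) * M (n + 1) ≤ b' n
  late_le : ∀ n, b' n * M n ≤ A (n + 1)
  main_zero_le : A 0 * M 0 ≤ 1

theorem exists_isSpacingScale {M : ℕ → ℝ} (hM : ∀ n, 1 ≤ M n) :
    ∃ A b b' : ℕ → ℝ, IsSpacingScale A b b' M := by
  obtain ⟨c, h0, hpos, hanti, hc⟩ := exists_rapidly_decreasing hM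
  -- The indices interleave as required: A (n + 1) = c (3n + 4), b' n = c (3n + 5), b (n + 1) = c
  -- (3n + 6).
  refine ⟨fun n => c (3 * n + 1), fun n => c (3 * n + 3), fun n => c (3 * n + 5),
    fun n => ⟨hpos _, hpos _, hpos _⟩, fun n => (hanti _).trans (hanti _),
    fun n => (hc (3 * n + 2) n (by omega)).trans (hanti _),
    fun n => hc (3 * n + 3) (n + 1) (by omega),
    fun n => hc (3 * n + 5) (n + 1) (by omega),
    fun n => hc (3 * n + 4) n (by omega), ?_⟩
  exact (hc 0 0 le_rfl).trans h0.le

namespace IsReturnScheme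

variable {C α : Type*} {T : C → C} {p : C} {q : ℕ → C → α}

/-- The spacing of the embedding. At level `n + 1` it decreases by the factor `ρ (n + 1)` along
orbits, except at visits to the `n`-th cell of `p` outside the next one. -/
noncomputable def spacing (T : C → C) (p : C) (q : ℕ → C → α) (A b b' ρ : ℕ → ℝ) : ℕ → C → ℝ
  | 0, _ => A 0
  | n + 1, x =>
    if hit T p q (n + 1) x = 0 then A (n + 1)
    else (if hit T p q n (T x) + 1 = hit T p q (n + 1) x then A (n + 1)
      else if hit T p q (n + 1) x = hit T p q (n + 2) x then b (n + 1) else b' (n + 1)) *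
        ρ (n + 1) ^ (hit T p q n (T x) + 1)

variable {A b b' ρ M : ℕ → ℝ}

theorem spacing_pos (hs : IsSpacingScale A b b' M) (hρ : ∀ n, 1 ≤ ρ n) (n : ℕ) (x : C) :
    0 < spacing T p q A b b' ρ n x := by
  cases n with
  | zero => exact (hs.pos 0).1
  | succ n =>
    obtain ⟨h1, h2, h3⟩ := hs.pos (n + 1)
    have : 0 < ρ (n + 1) ^ (hit T p q n (T x) + 1) := pow_pos (zero_lt_one.trans_le (hρ _)) _
    simp only [spacing]
    split_ifs <;> positivity

theorem late_le_spacing (hs : IsSpacingScale A b b' M) (hρ : ∀ n, 1 ≤ ρ n)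
    (hM : ∀ n, 1 ≤ M n) (n : ℕ) (x : C) : b' n ≤ spacing T p q A b b' ρ n x := by
  have hbA : ∀ n, b n ≤ A n := fun n =>
    (le_mul_of_one_le_right (hs.pos n).2.1.le (hM n)).trans (hs.early_le n)
  cases n with
  | zero => exact (hs.late_le_early 0).trans (hbA 0)
  | succ n =>
    have hl := hs.late_le_early (n + 1)
    have hpow : 1 ≤ ρ (n + 1) ^ (hit T p q n (T x) + 1) := one_le_pow₀ (hρ _)
    obtain ⟨hA, hb, hb'⟩ := hs.pos (n + 1)
    simp only [spacing]
    split_ifs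
    · exact hl.trans (hbA _)
    · exact (hl.trans (hbA _)).trans (le_mul_of_one_le_right hA.le hpow)
    · exact hl.trans (le_mul_of_one_le_right hb.le hpow)
    · exact le_mul_of_one_le_right hb'.le hpow

theorem early_le_spacing (hs : IsSpacingScale A b b' M)
    (hρ : ∀ n, 1 ≤ ρ n) (hM : ∀ n, 1 ≤ M n) {n : ℕ} {x : C}
    (hx : hit T p q n x = 0 ∨ hit T p q n x = hit T p q (n + 1) x) :
    b n ≤ spacing T p q A b b' ρ n x := by
  have hbA : ∀ n, b n ≤ A n := fun n =>
    (le_mul_of_one_le_right (hs.pos n).2.1.le (hM n)).trans (hs.early_le n)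
  cases n with
  | zero => exact hbA 0
  | succ n =>
    have hpow : 1 ≤ ρ (n + 1) ^ (hit T p q n (T x) + 1) := one_le_pow₀ (hρ _)
    obtain ⟨hA, hb, hb'⟩ := hs.pos (n + 1)
    simp only [spacing]
    split_ifs with h1 h2 h3
    · exact hbA _
    · exact (hbA _).trans (le_mul_of_one_le_right hA.le hpow)
    · exact le_mul_of_one_le_right hb.le hpow
    · exact absurd (hx.resolve_left h1) h3

variable [TopologicalSpace C] {L : ℕ → ℕ}

/-- The spacing has to be a function of the code. This is why the code carries its flag, which
decides between `b` and `b'`. -/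
theorem spacing_congr (h : IsReturnScheme T p q L) (n : ℕ) (x y : C)
    (hxy : code T p q n x = code T p q n y) :
    spacing T p q A b b' ρ n x = spacing T p q A b b' ρ n y := by
  cases n with
  | zero => rfl
  | succ n =>
    obtain ⟨h1, -, h3⟩ := code_eq_iff.1 hxy
    by_cases h0 : hit T p q (n + 1) x = 0
    · have h0' := h1.symm.trans h0
      simp only [spacing, h0, h0', if_true]
    · have h0' : hit T p q (n + 1) y ≠ 0 := fun h => h0 (h1.trans h)
      have hw := h.hit_map_eq_of_code hxy h0
      simp only [spacing, h0, h0', if_false, hw, h3 h0]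
      rw [h1]

theorem one_le_bound (h : IsReturnScheme T p q L) (n : ℕ) : 1 ≤ L n := by
  obtain ⟨j, h1, h2, -⟩ := h.returns n p
  omega

theorem pow_hit_le (h : IsReturnScheme T p q L) (hρ : ∀ n, 1 ≤ ρ n)
    (hM : ∀ n, ρ (n + 1) ^ (L n + 2) ≤ M (n + 1)) (n : ℕ) (x : C) :
    ρ (n + 1) * ρ (n + 1) ^ (hit T p q n x + 1) ≤ M (n + 1) := by
  rw [← pow_succ']
  exact (pow_le_pow_right₀ (hρ _) (by have := h.hit_le_bound n x; omega)).trans (hM n)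

/-- The exponent of `ρ` is the time to the next visit, at time at least 1, to the n-th cell of p,
and it drops by one per step until that visit. A visit to the smaller cell ends at the value `A`.
Leaving that cell starts from `b` or `b'`, because the first return to the larger cell misses the
smaller one; `early_le` absorbs the new power. -/
theorem spacing_map_le (h : IsReturnScheme T p q L) (hs : IsSpacingScale A b b' M)
    (hρ : ∀ n, 1 ≤ ρ n) (hM : ∀ n, ρ (n + 1) ^ (L n + 2) ≤ M (n + 1)) {n : ℕ} {x : C}
    (hx : ¬ (q n (T x) = q n p ∧ q (n + 1) (T x) ≠ q (n + 1) p)) :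
    ρ (n + 1) * spacing T p q A b b' ρ (n + 1) (T x) ≤ spacing T p q A b b' ρ (n + 1) x := by
  obtain ⟨hA, hb, hb'⟩ := hs.pos (n + 1)
  have hρ0 : 0 < ρ (n + 1) := zero_lt_one.trans_le (hρ _)
  rw [Ne, ← h.hit_eq_zero_iff, ← h.hit_eq_zero_iff] at hx
  have l1 := h.hit_le_hit_succ n (T x)
  by_cases h0 : hit T p q (n + 1) x = 0
  · have hne := h.hit_map_ne (h.hit_eq_zero_iff.1 h0)
    have h1 : hit T p q (n + 1) (T x) ≠ 0 := by omega
    have h2 : hit T p q n (T x) ≠ 0 := fun h => hx ⟨h, h1⟩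
    have h3 := h.hit_map h2
    have h4 : ¬ hit T p q n (T (T x)) + 1 = hit T p q (n + 1) (T x) := by omega
    simp only [spacing, h0, h1, h4, if_true, if_false]
    have h5 := h.pow_hit_le hρ hM n (T (T x))
    calc _ = (if hit T p q (n + 1) (T x) = hit T p q (n + 2) (T x) then b (n + 1)
          else b' (n + 1)) * (ρ (n + 1) * ρ (n + 1) ^ (hit T p q n (T (T x)) + 1)) := by ring
      _ ≤ b (n + 1) * M (n + 1) := by
        refine mul_le_mul ?_ h5 (by positivity) hb.le
        split_ifs
        · exact le_rfl
        · exact hs.late_le_early _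
      _ ≤ A (n + 1) := hs.early_le _
  · have h1 := h.hit_map h0
    by_cases h2 : hit T p q (n + 1) (T x) = 0
    · have h3 : hit T p q n (T x) + 1 = hit T p q (n + 1) x := by omega
      have h4 : hit T p q n (T x) = 0 := by omega
      simp only [spacing, h0, h2, h3, if_true, if_false]
      rw [← h1, h2]
      exact le_of_eq (by ring)
    · have h3 : hit T p q n (T x) ≠ 0 := fun h => hx ⟨h, h2⟩
      have h4 := h.hit_map h3
      have l2 : _ ≤ hit T p q (n + 2) x := h.hit_le_hit_succ (n + 1) x
      have h5 := h.hit_map (n := n + 2) (x := x) (by omega)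
      have e1 : hit T p q n (T (T x)) + 1 = hit T p q (n + 1) (T x) ↔
        hit T p q n (T x) + 1 = hit T p q (n + 1) x := by omega
      have e2 : hit T p q (n + 1) (T x) = hit T p q (n + 2) (T x) ↔
        hit T p q (n + 1) x = hit T p q (n + 2) x := by omega
      simp only [spacing, h0, h2, e1, e2, if_false]
      rw [h4, pow_succ]
      exact le_of_eq (by ring)

/-- A spacing of size `A (n + 1)` occurs only when x lies in the n-th cell or its next visit there
is also one to the smaller cell; then level n has spacing at least `b n`. Otherwise the spacing is
on the scale of `b (n + 1)`, below even `b' n`. -/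
theorem spacing_succ_le (h : IsReturnScheme T p q L) (hs : IsSpacingScale A b b' M)
    (hρ : ∀ n, 1 ≤ ρ n) (hM1 : ∀ n, 1 ≤ M n) (hM : ∀ n, ρ (n + 1) ^ (L n + 2) ≤ M (n + 1))
    (n : ℕ) (x : C) :
    ρ (n + 1) * spacing T p q A b b' ρ (n + 1) x ≤ spacing T p q A b b' ρ n x := by
  have hρ0 : 0 < ρ (n + 1) := zero_lt_one.trans_le (hρ _)
  obtain ⟨hA, hb, hb'⟩ := hs.pos (n + 1)
  have hρM : ρ (n + 1) ≤ M (n + 1) :=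
    (le_self_pow₀ (hρ _) (by omega)).trans (hM n)
  have hpow := h.pow_hit_le hρ hM n (T x)
  have l1 := h.hit_le_hit_succ n x
  by_cases h0 : hit T p q (n + 1) x = 0
  · simp only [spacing, h0, if_true]
    refine le_trans ?_ (early_le_spacing hs hρ hM1 (Or.inl (by omega)))
    rw [mul_comm]
    exact (mul_le_mul_of_nonneg_left hρM hA.le).trans (hs.main_succ_le n)
  by_cases h1 : hit T p q n (T x) + 1 = hit T p q (n + 1) x
  · have h2 : hit T p q n x = 0 ∨ hit T p q n x = hit T p q (n + 1) x := by
      by_cases h3 : hit T p q n x = 0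
      · exact Or.inl h3
      · have := h.hit_map h3
        omega
    refine le_trans ?_ (early_le_spacing hs hρ hM1 h2)
    refine le_trans ?_ (hs.main_succ_le n)
    simp only [spacing, h0, if_false]
    rw [if_pos h1, mul_left_comm]
    exact mul_le_mul_of_nonneg_left hpow hA.le
  · refine le_trans ?_ (late_le_spacing hs hρ hM1 n x)
    refine le_trans ?_ (hs.early_succ_le n)
    simp only [spacing, h0, h1, if_false]
    rw [mul_left_comm]
    refine mul_le_mul ?_ hpow (by positivity) hb.le
    split_ifs
    · exact le_rfl
    · exact hs.late_le_early _

/-- Pays for the level lost at p. The first visit of `T p` to a cell of p is never one to the next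
cell, so its spacing uses the late scale `b'`, which lies below the next `A`. -/
theorem spacing_map_base_le (h : IsReturnScheme T p q L) (hs : IsSpacingScale A b b' M)
    (hρ : ∀ n, 1 ≤ ρ n) (hM : ∀ n, ρ (n + 1) ^ (L n + 2) ≤ M (n + 1)) (n : ℕ) :
    ρ (n + 2) * spacing T p q A b b' ρ (n + 2) (T p) ≤ spacing T p q A b b' ρ (n + 3) p := by
  have h0 : ∀ n, hit T p q n p = 0 := fun n => h.hit_eq_zero_iff.2 rfl
  have hne : ∀ n, hit T p q n (T p) ≠ hit T p q (n + 1) (T p) := fun n =>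
    h.hit_map_ne (rfl : q (n + 1) p = q (n + 1) p)
  have h1 : hit T p q (n + 1) (T p) ≠ 0 := by
    rw [Ne, h.hit_eq_zero_iff]
    exact h.not_returns n p rfl 1 le_rfl (h.one_le_bound n)
  have l1 : _ ≤ hit T p q (n + 2) (T p) := h.hit_le_hit_succ (n + 1) (T p)
  have h2 := h.hit_map h1
  have h3 : hit T p q (n + 2) (T p) ≠ 0 := by omega
  have h4 : ¬ hit T p q (n + 1) (T (T p)) + 1 = hit T p q (n + 2) (T p) := by
    rw [h2]; exact hne _
  simp only [spacing, h0, h3, h4, hne (n + 2), if_true, if_false]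
  rw [mul_left_comm]
  exact (mul_le_mul_of_nonneg_left (h.pow_hit_le hρ hM (n + 1) _) (hs.pos _).2.2.le).trans
    (hs.late_le _)

end IsReturnScheme

/-! ### Return schemes from minimality -/

/-- The coordinates of a point with respect to the first `k` sets of a sequence. -/
def truncatedCode {C : Type*} (U : ℕ → Set C) (k : ℕ) (x : C) : ℕ → Prop := fun i => i < k ∧ x ∈ U i

section truncatedCode

variable {C : Type*} {U : ℕ → Set C}

theorem truncatedCode_eq_iff {k : ℕ} {x y : C} :
    truncatedCode U k x = truncatedCode U k y ↔ ∀ i < k, (x ∈ U i ↔ y ∈ U i) := by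
  unfold truncatedCode
  rw [funext_iff]
  refine forall_congr' fun i => ?_
  rw [eq_iff_iff]
  tauto

theorem truncatedCode_eq_of_le {k l : ℕ} (hkl : k ≤ l) {x y : C}
    (h : truncatedCode U l x = truncatedCode U l y) :
    truncatedCode U k x = truncatedCode U k y :=
  truncatedCode_eq_iff.2 fun i hi => truncatedCode_eq_iff.1 h i (hi.trans_le hkl)

theorem isLocallyConstant_truncatedCode [TopologicalSpace C] (hU : ∀ i, IsClopen (U i)) (k : ℕ) :
    IsLocallyConstant (truncatedCode U k) := by
  rw [IsLocallyConstant.iff_eventually_eq]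
  intro x
  have : ∀ᶠ y in nhds x, ∀ i ∈ Finset.range k, (y ∈ U i ↔ x ∈ U i) := by
    rw [Filter.eventually_all_finset]
    intro i _
    by_cases hx : x ∈ U i
    · filter_upwards [(hU i).isOpen.mem_nhds hx] with y hy
      simp [hx, hy]
    · filter_upwards [(hU i).compl.isOpen.mem_nhds hx] with y hy
      have : y ∉ U i := hy
      simp [hx, this]
  filter_upwards [this] with y hy
  exact truncatedCode_eq_iff.2 fun i hi => hy i (Finset.mem_range.2 hi)

theorem exists_truncatedCode_subset [TopologicalSpace C]
    (hU : TopologicalSpace.IsTopologicalBasis (range U)) {p : C} {V : Set C} (hV : IsOpen V)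
    (hp : p ∈ V) : ∃ k, ∀ y, truncatedCode U k y = truncatedCode U k p → y ∈ V := by
  obtain ⟨_, ⟨i, rfl⟩, hpi, hiV⟩ := hU.exists_subset_of_mem_open hp hV
  exact ⟨i + 1, fun y hy => hiV ((truncatedCode_eq_iff.1 hy i (Nat.lt_succ_self i)).2 hpi)⟩

end truncatedCode

theorem exists_return_bound {C : Type*} [TopologicalSpace C] [CompactSpace C] {T : C → C}
    (hT : Continuous T) (hd : ∀ x : C, Dense (range fun n : ℕ => T^[n] x)) {V : Set C}
    (hV : IsOpen V) (hne : V.Nonempty) : ∃ L, ∀ x, ∃ j, 1 ≤ j ∧ j ≤ L ∧ T^[j] x ∈ V := by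
  obtain ⟨s, hs⟩ := isCompact_univ.elim_finite_subcover (fun j : ℕ => T^[j + 1] ⁻¹' V)
    (fun j => hV.preimage (hT.iterate _)) (by
      intro x _
      -- Density is used for the orbit of `T x`, not of x, so that the return time is at least 1.
      obtain ⟨_, hy, ⟨n, rfl⟩⟩ := (hd (T x)).inter_open_nonempty V hV hne
      exact mem_iUnion.2 ⟨n, by simpa only [mem_preimage, iterate_succ_apply] using hy⟩)
  refine ⟨s.sup id + 1, fun x => ?_⟩
  obtain ⟨j, hj, hx⟩ := mem_iUnion₂.1 (hs (mem_univ x))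
  exact ⟨j + 1, by omega, Nat.succ_le_succ (Finset.le_sup (f := id) hj), hx⟩

namespace IsMinimalCantorSystem

variable {C : Type*} [MetricSpace C] {T : C → C}

/-- A periodic point would have a finite dense orbit, making `C` finite and hence discrete. -/
theorem iterate_ne (hT : IsMinimalCantorSystem T) (p : C) {j : ℕ} (hj : 1 ≤ j) : T^[j] p ≠ p := by
  intro hp
  have hper : IsPeriodicPt T j p := hp
  have hfin : (range fun n : ℕ => T^[n] p).Finite := by
    refine ((Finset.range j).finite_toSet.image fun n => T^[n] p).subset ?_
    rintro _ ⟨n, rfl⟩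
    exact ⟨n % j, by simpa using Nat.mod_lt n hj, hper.iterate_mod_apply n⟩
  have huniv : (range fun n : ℕ => T^[n] p) = univ := by
    rw [← hfin.isClosed.closure_eq]
    exact (hT.dense_orbit p).closure_eq
  have : Finite C := finite_univ_iff.1 (huniv ▸ hfin)
  exact hT.cantor.noIsolated p (isOpen_discrete _)

theorem exists_clopen_basis (hT : IsMinimalCantorSystem T) : ∃ U : ℕ → Set C,
    (∀ i, IsClopen (U i)) ∧ TopologicalSpace.IsTopologicalBasis (range U) := by
  have := hT.cantor.compact
  have := hT.cantor.nonempty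
  obtain ⟨s, hs, hc, hb⟩ := hT.cantor.zeroDimensional.exists_countable
  have hne : s.Nonempty := by
    obtain ⟨x⟩ := hT.cantor.nonempty
    obtain ⟨t, ht, -⟩ := hb.exists_subset_of_mem_open (mem_univ x) isOpen_univ
    exact ⟨t, ht⟩
  obtain ⟨U, rfl⟩ := hc.exists_eq_range hne
  exact ⟨U, fun i => hs (mem_range_self i), hb⟩

theorem exists_isReturnScheme (hT : IsMinimalCantorSystem T) (p : C) :
    ∃ (q : ℕ → C → ℕ → Prop) (L : ℕ → ℕ), IsReturnScheme T p q L := by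
  have := hT.cantor.compact
  obtain ⟨U, hU, hb⟩ := hT.exists_clopen_basis
  have hlc := isLocallyConstant_truncatedCode hU
  choose L hL using fun k => exists_return_bound hT.continuous hT.dense_orbit
    ((hlc k).isOpen_fiber (truncatedCode U k p)) ⟨p, rfl⟩
  have hshadow : ∀ k l, ∃ m, ∀ y, truncatedCode U m y = truncatedCode U m p →
      ∀ j ≤ l, truncatedCode U k (T^[j] y) = truncatedCode U k (T^[j] p) := by
    intro k l
    obtain ⟨m, hm⟩ := exists_truncatedCode_subset hb (p := p)
      (V := ⋂ j ∈ Iic l, {y | truncatedCode U k (T^[j] y) = truncatedCode U k (T^[j] p)})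
      ((finite_Iic l).isOpen_biInter fun j _ =>
        ((hlc k).comp_continuous (hT.continuous.iterate j)).isOpen_fiber _)
      (by simp)
    exact ⟨m, fun y hy j hj => mem_iInter₂.1 (hm y hy) j hj⟩
  have hstep : ∀ k, ∃ k', k + 1 ≤ k' ∧ ∀ y, truncatedCode U k' y = truncatedCode U k' p →
      (∀ j ≤ L k, truncatedCode U k (T^[j] y) = truncatedCode U k (T^[j] p)) ∧
      ∀ j, 1 ≤ j → j ≤ L k → truncatedCode U k' (T^[j] y) ≠ truncatedCode U k' p := by
    intro k
    -- Level k₂ separates p from its first `L k` iterates. If y shadows p at that level, an early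
    -- return of y would put an iterate of p in the k₂-cell of p.
    obtain ⟨k₂, hk₂⟩ := exists_truncatedCode_subset hb (p := p)
      (V := ((fun j => T^[j] p) '' Icc 1 (L k))ᶜ)
      (((finite_Icc 1 (L k)).image _).isClosed.isOpen_compl)
      (by rintro ⟨j, hj, hj'⟩; exact hT.iterate_ne p hj.1 hj')
    obtain ⟨m, hm⟩ := hshadow (max k k₂) (L k)
    refine ⟨max (k + 1) (max k₂ m), le_max_left _ _, fun y hy => ?_⟩
    have hy' := hm y (truncatedCode_eq_of_le (by omega) hy)
    refine ⟨fun j hj => truncatedCode_eq_of_le (by omega) (hy' j hj), fun j hj1 hj he => ?_⟩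
    have h1 : truncatedCode U k₂ (T^[j] p) = truncatedCode U k₂ p :=
      (truncatedCode_eq_of_le (le_max_right k k₂) (hy' j hj)).symm.trans
        (truncatedCode_eq_of_le (by omega) he)
    exact hk₂ _ h1 ⟨j, ⟨hj1, hj⟩, rfl⟩
  choose g hg1 hg2 using hstep
  set N : ℕ → ℕ := fun n => g^[n] 0 with hN
  have hNs : ∀ n, N (n + 1) = g (N n) := fun n => iterate_succ_apply' g n 0
  have hNn : ∀ n, n ≤ N n := by
    intro n
    induction n with
    | zero => exact Nat.zero_le _
    | succ n ih => rw [hNs]; exact (Nat.succ_le_succ ih).trans (hg1 _)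
  refine ⟨fun n => truncatedCode U (N n), fun n => L (N n), hT.continuous, fun n => hlc _,
    fun x y => ?_, fun n x y hxy => ?_, fun x y hxy => ?_, fun n x => hL (N n) x,
    fun n y hy => ?_, fun n y hy => ?_⟩
  · exact truncatedCode_eq_iff.2 fun i hi => absurd hi (Nat.not_lt_zero i)
  · refine truncatedCode_eq_of_le ?_ hxy
    rw [hNs]
    exact (Nat.le_succ _).trans (hg1 _)
  · by_contra hne
    obtain ⟨k, hk⟩ := exists_truncatedCode_subset hb (p := y) (V := {x}ᶜ) isOpen_compl_singleton
      (Ne.symm hne)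
    exact hk x (truncatedCode_eq_of_le (hNn k) (hxy k)) rfl
  · simp only [hNs] at hy
    exact (hg2 (N n) y hy).1
  · simp only [hNs] at hy ⊢
    exact (hg2 (N n) y hy).2

end IsMinimalCantorSystem

/-! ### The embedding with zero derivative and the conclusion -/

theorem IsLocallyConstant.exists_index {C β : Type*} [TopologicalSpace C] [CompactSpace C]
    {f : C → β} (hf : IsLocallyConstant f) :
    ∃ (ι : C → ℕ) (k : ℕ), (∀ x, ι x < k) ∧ ∀ x y, ι x = ι y ↔ f x = f y := by
  have : Finite (range f) := hf.range_finite
  obtain ⟨k, ⟨e⟩⟩ := Finite.exists_equiv_fin (range f)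
  refine ⟨fun x => e (rangeFactorization f x), k, fun x => (e _).2, fun x y => ?_⟩
  rw [Fin.val_inj, e.injective.eq_iff, Subtype.ext_iff]
  rfl

/-- A system with a return scheme embeds into `[0, 1]` so that its map has zero derivative. -/
theorem IsReturnScheme.exists_embedding {C α : Type*} [TopologicalSpace C] [CompactSpace C]
    {T : C → C} {p : C} {q : ℕ → C → α} {L : ℕ → ℕ} (h : IsReturnScheme T p q L) :
    ∃ π : C → ℝ, Continuous π ∧ Injective π ∧ (∀ x, π x ∈ Icc (0 : ℝ) 1) ∧
      ∀ x, ∀ ε > 0, ∀ᶠ y in nhds x, |π (T y) - π (T x)| ≤ ε * |π y - π x| := by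
  choose ι k hιk hι using fun n => (h.isLocallyConstant_code (n + 1)).exists_index
  have hk1 : ∀ n, (1 : ℝ) ≤ k n := fun n => by
    exact_mod_cast Nat.one_le_iff_ne_zero.2 (Nat.ne_zero_of_lt (hιk n p))
  -- The factor `8 * k n` is what the tree coding needs; the unbounded factor n + 1 makes the
  -- difference quotients tend to 0.
  set ρ : ℕ → ℝ := fun n => 8 * (n + 1) * k n with hρdef
  have hρk : ∀ n, 8 * (k n : ℝ) ≤ ρ n := fun n => by
    have : (0 : ℝ) ≤ n * k n := by positivity
    simp only [hρdef]
    linarith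
  have hρ : ∀ n, 1 ≤ ρ n := fun n => by linarith [hρk n, hk1 n]
  -- Level n + 1 involves hitting times bounded by `L n`. At n = 0 the truncated index is harmless,
  -- since a positive exponent is all that is needed there.
  set M : ℕ → ℝ := fun n => ρ n ^ (L (n - 1) + 2) with hMdef
  have hM1 : ∀ n, 1 ≤ M n := fun n => one_le_pow₀ (hρ n)
  have hM : ∀ n, ρ (n + 1) ^ (L n + 2) ≤ M (n + 1) := fun n => le_rfl
  obtain ⟨A, b, b', hs⟩ := exists_isSpacingScale hM1
  set D := spacing T p q A b b' ρ with hD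
  have hDpos : ∀ n x, 0 < D n x := spacing_pos hs hρ
  have tc : IsTreeCoding (code T p q) ι k D :=
    { isLocallyConstant := h.isLocallyConstant_code
      trivial_zero := h.code_zero
      refines := h.code_refines
      separates := h.code_separates
      index_eq_iff := hι
      index_lt := hιk
      spacing_pos := hDpos
      spacing_congr := h.spacing_congr
      spacing_succ := fun n x => (mul_le_mul_of_nonneg_right (hρk (n + 1))
        (hDpos _ x).le).trans (h.spacing_succ_le hs hρ hM1 hM n x)
      spacing_zero := fun x => by
        have h1 : 2 * (k 0 : ℝ) ≤ M 0 :=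
          (by linarith [hρk 0, hk1 0] : 2 * (k 0 : ℝ) ≤ ρ 0).trans
            (le_self_pow₀ (hρ 0) (by omega))
        have h2 := mul_le_mul_of_nonneg_right h1 (hs.pos 0).1.le
        have h3 := hs.main_zero_le
        simp only [hD, spacing]
        linarith }
  refine ⟨IsTreeCoding.embed D ι, tc.continuous, tc.injective, tc.embed_mem_Icc, ?_⟩
  have hmono : ∀ {m n : ℕ}, m ≤ n → ∀ {x y : C}, q n x = q n y → q m x = q m y := by
    intro m n hmn x y hxy
    induction n, hmn using Nat.le_induction with
    | base => exact hxy
    | succ n _ ih => exact ih (h.refines n x y hxy)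
  have hout : ∀ x, x ≠ p → ∃ m, ∀ n ≥ m, q n x ≠ q n p := by
    intro x hx
    by_contra! hcon
    refine hx (h.separates x p fun n => ?_)
    obtain ⟨l, hl, he⟩ := hcon n
    exact hmono hl he
  -- The class of `T x` is taken at level l = n + 1 for x ≠ p and at l = n for x = p. The threshold
  -- m discards the finitely many levels where x is still in the cell of p or the step to `T x` is
  -- exempt from contraction.
  have hlevel : ∀ x, ∃ m, ∀ n ≥ m, ∀ y, code T p q (n + 1) x = code T p q (n + 1) y →
      ∃ l ≥ n, code T p q l (T x) = code T p q l (T y) ∧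
        ρ l * D l (T x) ≤ D (n + 1) x := by
    intro x
    by_cases hx : x = p
    · subst hx
      refine ⟨2, fun n hn y hxy => ⟨n, le_rfl, ?_, ?_⟩⟩
      · exact (h.code_map_base (h.code_eq_base_iff.1 hxy.symm)).symm
      · obtain ⟨j, rfl⟩ := Nat.exists_eq_add_of_le' hn
        exact h.spacing_map_base_le hs hρ hM j
    · obtain ⟨m, hm⟩ := hout x hx
      have hTx : ∃ m, ∀ n ≥ m, ¬ (q n (T x) = q n p ∧ q (n + 1) (T x) ≠ q (n + 1) p) := by
        by_cases hp : T x = p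
        · exact ⟨0, fun n _ hn => hn.2 (by rw [hp])⟩
        · obtain ⟨m, hm⟩ := hout _ hp
          exact ⟨m, fun n hn h' => hm n hn h'.1⟩
      obtain ⟨m', hm'⟩ := hTx
      refine ⟨max m m', fun n hn y hxy => ⟨n + 1, Nat.le_succ n, ?_, ?_⟩⟩
      · refine h.code_map hxy fun h0 => hm (n + 1) ?_ (h.hit_eq_zero_iff.1 h0)
        exact ((le_max_left m m').trans hn).trans (Nat.le_succ n)
      · exact h.spacing_map_le hs hρ hM (hm' n ((le_max_right m m').trans hn))
  intro x ε hε
  obtain ⟨m, hm⟩ := hlevel x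
  obtain ⟨N, hN⟩ := exists_nat_ge (1 / ε)
  filter_upwards [(h.isLocallyConstant_code (max m N + 1)).eventually_eq x] with y hy
  by_cases hxy : x = y
  · simp [hxy]
  obtain ⟨n', h1, h2⟩ := tc.exists_split hxy
  have hn' : max m N + 1 ≤ n' := by
    by_contra! hlt
    exact h2 (tc.eq_of_le hlt hy.symm)
  obtain ⟨n, rfl⟩ := Nat.exists_eq_succ_of_ne_zero (n := n') (by omega)
  obtain ⟨l, hl, hc, hle⟩ := hm n (by omega) y h1
  have h3 := tc.abs_embed_sub_le hc
  have h4 := tc.le_abs_embed_sub h1 h2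
  rw [abs_sub_comm] at h3 h4
  have hlN : (N : ℝ) ≤ l := by exact_mod_cast (show N ≤ l by omega)
  have h5 : 1 ≤ ε * (l + 1) := by
    have := (div_le_iff₀ hε).1 (hN.trans hlN)
    linarith
  refine h3.trans ?_
  have hkD : 0 ≤ 2 * k l * D l (T x) := by
    have := (hDpos l (T x)).le
    positivity
  calc 2 * k l * D l (T x) ≤ 2 * k l * D l (T x) * (ε * (l + 1)) := le_mul_of_one_le_right hkD h5
    _ = ε * (ρ l * D l (T x) / 4) := by simp only [hρdef]; ring
    _ ≤ ε * (D (n + 1) x / 2) := by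
      have := (hDpos (n + 1) x).le
      gcongr
      linarith
    _ ≤ _ := by gcongr

theorem mainTheorem2 {C : Type*} [MetricSpace C] (T : C → C) (hT : IsMinimalCantorSystem T) :
    ∃ (f : ℝ → ℝ) (K : Set ℝ) (π : C ≃ₜ K),
      IsDifferentiableIntervalSystem f ∧
      IsMinimalSubsystem f K ∧
      (∀ x : C, f (π x) = π (T x)) ∧
      ∀ y ∈ K, HasDerivWithinAt f 0 (Icc 0 1) y := by
  have := hT.cantor.compact
  obtain ⟨p⟩ := hT.cantor.nonempty
  obtain ⟨q, L, h⟩ := hT.exists_isReturnScheme p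
  obtain ⟨π, hc, hinj, h01, hd⟩ := h.exists_embedding
  have hemb : Topology.IsEmbedding π := (hc.isClosedEmbedding hinj).isEmbedding
  have : Nonempty C := ⟨p⟩
  have hg : ∀ x, (π ∘ T ∘ invFun π) (π x) = π (T x) := fun x => by
    simp only [comp_apply, leftInverse_invFun hinj x]
  have hK01 : range π ⊆ Icc 0 1 := by rintro _ ⟨x, rfl⟩; exact h01 x
  have hKc : IsClosed (range π) := (isCompact_range hc).isClosed
  obtain ⟨f, hfg, hfd, hf01, hf0⟩ := exists_differentiable_extension hKc hK01
    (g := π ∘ T ∘ invFun π) (fun y _ => h01 _) (by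
      rintro _ ⟨x, rfl⟩ ε hε
      have h1 := hd x ε hε
      have h2 : ∀ᶠ z in nhdsWithin (π x) (range π),
          |(π ∘ T ∘ invFun π) z - (π ∘ T ∘ invFun π) (π x)| ≤ ε * |z - π x| := by
        -- Since π is an embedding, neighbourhoods in `C` are relative neighbourhoods in the image,
        -- which turns the estimate into one in terms of δ.
        rw [← hemb.map_nhds_eq, Filter.eventually_map]
        simpa only [hg] using h1
      obtain ⟨δ, hδ, hball⟩ := Metric.eventually_nhds_iff.1 (eventually_nhdsWithin_iff.1 h2)
      exact ⟨δ, hδ, fun z hz hzx => hball (by rwa [Real.dist_eq]) hz⟩)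
  have hf : ∀ x, f (π x) = π (T x) := fun x => (hfg (mem_range_self x)).trans (hg x)
  have hfn : ∀ n x, f^[n] (π x) = π (T^[n] x) := by
    intro n
    induction n with
    | zero => exact fun x => rfl
    | succ n ih => exact fun x => by rw [iterate_succ_apply, hf, ih, iterate_succ_apply]
  refine ⟨f, range π, hemb.toHomeomorph, ⟨fun z _ => hf01 z, hfd.differentiableOn⟩,
    ⟨hK01, range_nonempty π, hKc, ?_, ?_⟩, hf, fun y hy => (hf0 y hy).hasDerivWithinAt⟩
  · rintro _ ⟨x, rfl⟩
    exact ⟨T x, (hf x).symm⟩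
  · rintro _ ⟨x, rfl⟩
    have : (range fun n : ℕ => f^[n] (π x)) = π '' range fun n : ℕ => T^[n] x := by
      rw [← range_comp]
      exact congrArg range (funext fun n => hfn n x)
    rw [this]
    exact hc.range_subset_closure_image_dense (hT.dense_orbit x)
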